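/- Let $\ell\ge 1$, $n\ge 2$ and $m\ge 0$ be integers, and let $T$ be the class of decision stumps on $\ell$ real-valued features with labels in $\{1,\dots,n\}$: the functions $t:\mathbb{R}^\ell\to\{1,\dots,n\}$ for which there are a feature $i\in\{1,\dots,\ell\}$, a threshold $\theta\in\mathbb{R}$, a sign $s\in\{\pm1\}$ and labels $c,c'\in\{1,\dots,n\}$ with $t(\mathbf{x})=c$ if $\operatorname{sign}(x^i-\theta)=s$ and $t(\mathbf{x})=c'$ otherwise, where $\operatorname{sign}(u)=+1$ if $u>0$ and $\operatorname{sign}(u)=-1$ if $u\le 0$. A $2$-partition of a finite set $S\subset\mathbb{R}^\ell$ is a set of two disjoint non-empty subsets (parts) of $S$ whose union is $S$; it is realizable by $T$ if some $t\in T$ takes equal values on any two elements of the same part and different values on any two elements of different parts. Let $\pi^2_T(m)$ be the largest number of distinct $2$-partitions realizable by $T$ on a set $S\subset\mathbb{R}^\ell$ with exactly $m$ elements. Then $$\pi^2_T(m)\le\frac12\sum_{k=1}^{m-1}\min\left\{2\ell,\binom{m}{k}\right\},$$ and equality holds whenever $2\ell\le m$, whenever $2\ell\ge\binom{m}{\lfloor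 m/2\rfloor}$, and whenever $1\le m\le 7$. -/

import Mathlib

/-- Structures of binary trees: the underlying graph of a tree, without decision rules and labels.
Every internal node has exactly two children. -/
inductive TreeShape where
  | leaf : TreeShape
  | node : TreeShape → TreeShape → TreeShape

/-- The binary sign: `+1` on positive reals and `-1` on all other reals (`0` included).
The group of units of `ℤ` is `{1, -1}`. -/
noncomputable def binSign (u : ℝ) : ℤˣ := if 0 < u then 1 else -1

/-- Binary decision trees on examples with `ℓ` real-valued features and labels in `Fin n`.
A leaf carries a class label; an internal node carries a decision rule (a feature `i`,
a threshold `θ`, a sign `s`), a left subtree and a right subtree. -/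
inductive DecisionTree (ℓ n : ℕ) where
  | leaf (label : Fin n) : DecisionTree ℓ n
  | node (i : Fin ℓ) (θ : ℝ) (s : ℤˣ) (left right : DecisionTree ℓ n) : DecisionTree ℓ n

namespace DecisionTree

/-- The output of a binary decision tree on an example `x`. -/
noncomputable def output {ℓ n : ℕ} : DecisionTree ℓ n → (Fin ℓ → ℝ) → Fin n
  | leaf label, _ => label
  | node i θ s left right, x =>
      if binSign (x i - θ) = s then left.output x else right.output x

/-- The structure underlying a decision tree. -/
def shape {ℓ n : ℕ} : DecisionTree ℓ n → TreeShape
  | leaf _ => TreeShape.leaf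
  | node _ _ _ left right => TreeShape.node left.shape right.shape

end DecisionTree

/-- The class of all binary decision trees of a fixed structure: the decision rules at the nodes
and the class labels at the leaves are free. -/
def treeClass (ℓ n : ℕ) (σ : TreeShape) : Set (DecisionTree ℓ n) :=
  {t | t.shape = σ}

/-- The class of decision stumps: trees with one internal node and two leaves. -/
def decisionStumps (ℓ n : ℕ) : Set (DecisionTree ℓ n) :=
  treeClass ℓ n (TreeShape.node TreeShape.leaf TreeShape.leaf)

/-- A partition `P` of a sample `S` is realizable by the class `T` if some tree of `T` gives equal
outputs on examples of the same part and different outputs on examples of distinct parts. -/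
def Realizable {ℓ n : ℕ} (T : Set (DecisionTree ℓ n)) {S : Finset (Fin ℓ → ℝ)}
    (P : Finpartition S) : Prop :=
  ∃ t ∈ T,
    (∀ A ∈ P.parts, ∀ x ∈ A, ∀ y ∈ A, t.output x = t.output y) ∧
    (∀ A ∈ P.parts, ∀ B ∈ P.parts, A ≠ B → ∀ x ∈ A, ∀ y ∈ B, t.output x ≠ t.output y)

/-- The set of all partitions of the sample `S` into exactly `a` (non-empty) parts that are
realizable by the class `T`. -/
def realizablePartitions {ℓ n : ℕ} (T : Set (DecisionTree ℓ n)) (a : ℕ)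
    (S : Finset (Fin ℓ → ℝ)) : Set (Finpartition S) :=
  {P | P.parts.card = a ∧ Realizable T P}

/-- The `a`-partitioning function of the class `T`: the largest number of `a`-partitions that `T`
realizes on a sample of `m` examples. The supremum is taken over a bounded set, and for `0 < ℓ`
it is a maximum (see the two lemmas below). -/
noncomputable def partitioningFunction {ℓ n : ℕ} (T : Set (DecisionTree ℓ n)) (a m : ℕ) : ℕ :=
  sSup {N : ℕ | ∃ S : Finset (Fin ℓ → ℝ), S.card = m ∧ N = (realizablePartitions T a S).ncard}

lemma partitioningFunction_bddAbove {ℓ n : ℕ} (T : Set (DecisionTree ℓ n)) (a m : ℕ) :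
    BddAbove {N : ℕ | ∃ S : Finset (Fin ℓ → ℝ),
      S.card = m ∧ N = (realizablePartitions T a S).ncard} := by
  refine ⟨2 ^ 2 ^ m, ?_⟩
  rintro N ⟨S, hS, rfl⟩
  have h : (realizablePartitions T a S).ncard ≤
      ((S.powerset.powerset : Finset (Finset (Finset (Fin ℓ → ℝ)))) :
        Set (Finset (Finset (Fin ℓ → ℝ)))).ncard := by
    refine Set.ncard_le_ncard_of_injOn (fun P => P.parts) ?_ ?_ (Finset.finite_toSet _)
    · intro P _
      simp only [Finset.mem_coe, Finset.mem_powerset]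
      intro A hA
      exact Finset.mem_powerset.2 (P.le hA)
    · intro P _ Q _ hPQ
      exact Finpartition.ext hPQ
  rwa [Set.ncard_coe_finset, Finset.card_powerset, Finset.card_powerset, hS] at h

lemma partitioningFunction_isGreatest {ℓ n : ℕ} (hℓ : 0 < ℓ) (T : Set (DecisionTree ℓ n))
    (a m : ℕ) :
    IsGreatest {N : ℕ | ∃ S : Finset (Fin ℓ → ℝ),
      S.card = m ∧ N = (realizablePartitions T a S).ncard} (partitioningFunction T a m) := by
  have : Nonempty (Fin ℓ) := ⟨⟨0, hℓ⟩⟩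
  obtain ⟨S, hS⟩ := Infinite.exists_subset_card_eq (Fin ℓ → ℝ) m
  exact ⟨Nat.sSup_mem ⟨_, S, hS, rfl⟩ (partitioningFunction_bddAbove T a m),
    fun _ hN => le_csSup (partitioningFunction_bddAbove T a m) hN⟩

/-!
A realizable `2`-partition is determined by either of its two sides, and a stump cuts off a side by
one threshold on one feature. So twice the number of realizable `2`-partitions of `S` is the number
of proper non-empty subsets of `S` that are cut off
(`two_mul_ncard_realizablePartitions`). Cuts of one size by one feature in one direction are nested,
hence equal; this leaves at most `min (2 * ℓ) (m.choose k)` cuts of size `k` (`card_cuts_le`) and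
proves the upper bound.

Conversely, what a feature cuts off from `m` points is a maximal chain of subsets together with
the complements of its members, and every maximal chain arises in this way. The bound is attained
as soon as `ℓ` chains and their complements contain `min (2 * ℓ) (m.choose k)` sets of every size
`k` (`two_mul_partitioningFunction_eq_of_chains`). Such chains are found as follows.

* If `2 * ℓ ≤ m`, arrange the points on a cycle and let the chains grow evenly to both sides of
  `ℓ` consecutive centres. The complement of an interval is centred at the antipode, so all
  intervals of the same length are distinct (`le_card_chainCuts_cycChain`).
* If `m.choose (m / 2) ≤ 2 * ℓ`, every set has to be cut off. By Hall's theorem the sets below the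
  middle level are covered by chains, one below each set of size `m / 2` (`exists_descent`). A chain
  below `A` and the complements of a chain below `B` combine to a maximal chain when `A` and `B` are
  disjoint, so it remains to pair up the sets of size `m / 2` disjointly, up to one of them
  (`exists_disjoint_pairs`). For even `m` complementation does this. For odd `m` it is a
  near-perfect matching of the odd graph, which exists in every connected vertex-transitive graph by
  Gallai's argument (`exists_near_perfect_matching`): if some vertex is missed by a maximum matching
  then by symmetry every vertex is. "No maximum matching misses both `u` and `v`" then is a
  transitive relation, as one sees by exchanging two matchings along an alternating path, and it
  holds for adjacent vertices.
* If `m ≤ 7`, the few values of `ℓ` between these two ranges are settled by explicit orderings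
  of the points.
-/

/-! ### Sides of realizable partitions -/

/-- `A` is one of the two sides into which a single threshold on a single feature splits `S`.
The two sides play symmetric roles, and either may be empty. -/
def IsCut {ℓ : ℕ} (S A : Finset (Fin ℓ → ℝ)) : Prop :=
  A ⊆ S ∧ ∃ (i : Fin ℓ) (θ : ℝ), (∀ x ∈ S, x ∈ A ↔ x i ≤ θ) ∨ (∀ x ∈ S, x ∈ A ↔ θ < x i)

open Classical in
/-- The sides of size `k` that a single threshold can cut off the sample `S`. -/
noncomputable def cuts {ℓ : ℕ} (S : Finset (Fin ℓ → ℝ)) (k : ℕ) : Finset (Finset (Fin ℓ → ℝ)) :=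
  {A ∈ S.powersetCard k | IsCut S A}

lemma mem_cuts {ℓ : ℕ} {S A : Finset (Fin ℓ → ℝ)} {k : ℕ} :
    A ∈ cuts S k ↔ IsCut S A ∧ A.card = k := by
  classical
  rw [cuts, Finset.mem_filter, Finset.mem_powersetCard]
  exact ⟨fun h => ⟨h.2, h.1.2⟩, fun h => ⟨⟨h.1.1, h.2⟩, h.1⟩⟩

lemma binSign_eq_iff (u v : ℝ) : binSign u = binSign v ↔ (0 < u ↔ 0 < v) := by
  have h : (1 : ℤˣ) ≠ -1 := by decide
  unfold binSign
  by_cases hu : 0 < u <;> by_cases hv : 0 < v <;> simp [hu, hv, h, h.symm]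

lemma Finpartition.parts_eq_pair {α : Type*} [DecidableEq α] {S : Finset α} (P : Finpartition S)
    (h : P.parts.card = 2) {A : Finset α} (hA : A ∈ P.parts) :
    P.parts = {A, S \ A} ∧ A ≠ S \ A ∧ S \ A ∈ P.parts := by
  obtain ⟨B, hB⟩ : ∃ B, P.parts.erase A = {B} := by
    rw [← Finset.card_eq_one, Finset.card_erase_of_mem hA, h]
  have hBP : B ∈ P.parts.erase A := by simp [hB]
  have hBA : B ≠ A := Finset.ne_of_mem_erase hBP
  have hBp : B ∈ P.parts := Finset.mem_of_mem_erase hBP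
  have hparts : P.parts = {A, B} := by rw [← Finset.insert_erase hA, hB]
  have hdisj : Disjoint A B := P.disjoint hA hBp hBA.symm
  have hsup : A ∪ B = S := by
    have := P.sup_parts
    rw [hparts] at this
    simpa using this
  have : S \ A = B := by
    rw [← hsup, Finset.union_sdiff_left, Finset.sdiff_eq_self_of_disjoint hdisj.symm]
  rw [this]
  exact ⟨hparts, hBA.symm, hBp⟩

lemma exists_mem_realizablePartitions_iff {ℓ n : ℕ} (hn : 2 ≤ n) {S A : Finset (Fin ℓ → ℝ)} :
    (∃ P ∈ realizablePartitions (decisionStumps ℓ n) 2 S, A ∈ P.parts) ↔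
      IsCut S A ∧ A ≠ ∅ ∧ A ≠ S := by
  constructor
  · rintro ⟨P, ⟨hcard, t, ht, hsame, hdiff⟩, hA⟩
    obtain ⟨-, hne, hB⟩ := P.parts_eq_pair hcard hA
    have hAS : A ⊆ S := P.le hA
    have hA0 : A ≠ ∅ := P.ne_bot hA
    have hB0 : S \ A ≠ ∅ := P.ne_bot hB
    refine ⟨⟨hAS, ?_⟩, hA0, fun h => hB0 (by simp [h])⟩
    obtain ⟨a, ha⟩ := Finset.nonempty_iff_ne_empty.2 hA0
    obtain ⟨b, hb⟩ := Finset.nonempty_iff_ne_empty.2 hB0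
    -- A tree with the shape of a stump is a node over two leaves.
    match t, ht with
    | .node i θ s (.leaf c) (.leaf c'), _ =>
      simp only [DecisionTree.output] at hsame hdiff
      have hab := hdiff A hA _ hB hne a ha b hb
      -- Membership in `A` is decided by whether the sign agrees with that of `a`.
      have key : ∀ x ∈ S, x ∈ A ↔ binSign (x i - θ) = binSign (a i - θ) := by
        intro x hx
        constructor
        · intro hxA
          have h1 := hsame A hA x hxA a ha
          have h2 := hdiff A hA _ hB hne x hxA b hb
          by_contra hcon
          rcases Int.units_eq_one_or (binSign (x i - θ)) with e1 | e1 <;>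
          rcases Int.units_eq_one_or (binSign (a i - θ)) with e2 | e2 <;>
          rcases Int.units_eq_one_or (binSign (b i - θ)) with e3 | e3 <;>
          simp_all
        · intro hxs
          by_contra hxA
          exact hdiff A hA _ hB hne a ha x (Finset.mem_sdiff.2 ⟨hx, hxA⟩) (by rw [hxs])
      refine ⟨i, θ, ?_⟩
      by_cases h : 0 < a i - θ
      · right
        intro x hx
        rw [key x hx, binSign_eq_iff]
        simp [h, sub_pos]
      · left
        intro x hx
        rw [key x hx, binSign_eq_iff]
        simp [h, sub_pos]
  · rintro ⟨⟨hAS, i, θ, hcut⟩, hA0, hAS'⟩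
    have hB0 : S \ A ≠ ∅ := fun h => hAS' (hAS.antisymm (Finset.sdiff_eq_empty_iff_subset.1 h))
    have hdisj : Disjoint (S \ A) A := Finset.sdiff_disjoint
    let P : Finpartition S := (Finpartition.indiscrete (a := S \ A) hB0).extend
      (b := A) (c := S) hA0 hdisj (Finset.sdiff_union_of_subset hAS)
    have hP : P.parts = {A, S \ A} := rfl
    have hne : A ≠ S \ A := by
      intro h
      rw [← h] at hdisj
      exact hA0 (by simpa using hdisj)
    have hsign : ∀ x ∈ S, ∀ y ∈ S,
        (binSign (x i - θ) = 1 ↔ binSign (y i - θ) = 1) ↔ (x ∈ A ↔ y ∈ A) := by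
      have h1 : ∀ u, binSign u = 1 ↔ 0 < u := fun u => by
        rw [show (1 : ℤˣ) = binSign 1 by simp [binSign], binSign_eq_iff]
        simp
      intro x hx y hy
      simp only [h1, sub_pos]
      rcases hcut with h | h
      · rw [h x hx, h y hy, ← not_lt, ← not_lt]
        tauto
      · rw [h x hx, h y hy]
    have hout : ∀ x ∈ S, ∀ y ∈ S,
        (DecisionTree.node i θ 1 (.leaf ⟨0, by omega⟩) (.leaf ⟨1, by omega⟩) :
          DecisionTree ℓ n).output x = (DecisionTree.node i θ 1 (.leaf ⟨0, by omega⟩)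
          (.leaf ⟨1, by omega⟩)).output y ↔ (x ∈ A ↔ y ∈ A) := by
      intro x hx y hy
      rw [← hsign x hx y hy]
      simp only [DecisionTree.output]
      by_cases hx1 : binSign (x i - θ) = 1 <;> by_cases hy1 : binSign (y i - θ) = 1 <;>
        simp [hx1, hy1]
    refine ⟨P, ⟨?_, .node i θ 1 (.leaf ⟨0, by omega⟩) (.leaf ⟨1, by omega⟩), rfl, ?_, ?_⟩, ?_⟩
    · rw [hP, Finset.card_pair hne]
    · intro X hX x hx y hy
      rw [hout x (P.le hX hx) y (P.le hX hy)]
      rw [hP, Finset.mem_insert, Finset.mem_singleton] at hX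
      rcases hX with rfl | rfl
      · simp [hx, hy]
      · simp [(Finset.mem_sdiff.1 hx).2, (Finset.mem_sdiff.1 hy).2]
    · intro X hX Y hY hXY x hx y hy
      rw [Ne, hout x (P.le hX hx) y (P.le hY hy)]
      rw [hP, Finset.mem_insert, Finset.mem_singleton] at hX hY
      rcases hX with rfl | rfl <;> rcases hY with rfl | rfl
      · exact absurd rfl hXY
      · simp [hx, (Finset.mem_sdiff.1 hy).2]
      · simp [hy, (Finset.mem_sdiff.1 hx).2]
      · exact absurd rfl hXY
    · simp [hP]

/-- A realizable `2`-partition is determined by either of its two sides, so the proper non-empty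
cuts, sorted by size, count every realizable `2`-partition twice. -/
lemma two_mul_ncard_realizablePartitions {ℓ n : ℕ} (hn : 2 ≤ n) (S : Finset (Fin ℓ → ℝ)) :
    2 * (realizablePartitions (decisionStumps ℓ n) 2 S).ncard =
      ∑ k ∈ Finset.Ico 1 S.card, (cuts S k).card := by
  classical
  set R := (realizablePartitions (decisionStumps ℓ n) 2 S).toFinset with hR
  have hcardR : (realizablePartitions (decisionStumps ℓ n) 2 S).ncard = R.card := by
    rw [hR, Set.ncard_eq_toFinset_card']
  have hdisj : Set.PairwiseDisjoint (R : Set (Finpartition S)) (fun P => P.parts) := by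
    intro P hP Q hQ hPQ
    have hP' := (Set.mem_toFinset.1 (Finset.mem_coe.1 hP)).1
    have hQ' := (Set.mem_toFinset.1 (Finset.mem_coe.1 hQ)).1
    refine Finset.disjoint_left.2 fun A hA hA' => hPQ (Finpartition.ext ?_)
    rw [(P.parts_eq_pair hP' hA).1, (Q.parts_eq_pair hQ' hA').1]
  have hcuts : Set.PairwiseDisjoint (Finset.Ico 1 S.card : Set ℕ) (fun k => cuts S k) := by
    intro k _ k' _ hkk'
    refine Finset.disjoint_left.2 fun A hA hA' => hkk' ?_
    rw [← (mem_cuts.1 hA).2, ← (mem_cuts.1 hA').2]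
  have hunion : R.biUnion (fun P => P.parts) = (Finset.Ico 1 S.card).biUnion (cuts S) := by
    ext A
    have := exists_mem_realizablePartitions_iff hn (S := S) (A := A)
    simp only [Finset.mem_biUnion, hR, Set.mem_toFinset, this, mem_cuts, Finset.mem_Ico]
    constructor
    · rintro ⟨hc, h0, hS⟩
      exact ⟨A.card, ⟨Finset.card_pos.2 (Finset.nonempty_iff_ne_empty.2 h0),
        Finset.card_lt_card (hc.1.ssubset_of_ne hS)⟩, hc, rfl⟩
    · rintro ⟨k, ⟨h1, h2⟩, hc, rfl⟩
      refine ⟨hc, ?_, ?_⟩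
      · rintro rfl
        simp at h1
      · rintro rfl
        exact lt_irrefl _ h2
  rw [hcardR, ← Finset.card_biUnion hcuts, ← hunion, Finset.card_biUnion hdisj, mul_comm]
  symm
  apply Finset.sum_const_nat
  intro P hP
  exact (Set.mem_toFinset.1 hP).1

/-! ### The upper bound -/

/-- Cuts of a given size made by the same feature in the same direction form a chain, hence
coincide: there are at most two for each feature. -/
lemma card_cuts_le {ℓ : ℕ} (S : Finset (Fin ℓ → ℝ)) (k : ℕ) :
    (cuts S k).card ≤ min (2 * ℓ) (S.card.choose k) := by
  classical
  refine le_min ?_ ?_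
  · have hex : ∀ A : cuts S k, ∃ ib : Fin ℓ × Bool, ∃ θ : ℝ,
        ∀ x ∈ S, x ∈ A.1 ↔ if ib.2 then x ib.1 ≤ θ else θ < x ib.1 := by
      rintro ⟨A, hA⟩
      obtain ⟨⟨-, i, θ, h | h⟩, -⟩ := mem_cuts.1 hA
      · exact ⟨(i, true), θ, by simpa using h⟩
      · exact ⟨(i, false), θ, by simpa using h⟩
    choose f θ hf using hex
    have hinj : Function.Injective f := by
      intro A B hAB
      have hA := mem_cuts.1 A.2
      have hB := mem_cuts.1 B.2
      have hcomp : A.1 ⊆ B.1 ∨ B.1 ⊆ A.1 := by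
        have h1 := hf A
        have h2 := hf B
        rw [← hAB] at h2
        rcases le_total (θ A) (θ B) with h | h <;> rcases hb : (f A).2 with _ | _ <;>
          simp only [hb, if_true, Bool.false_eq_true, if_false] at h1 h2
        · exact Or.inr fun x hx =>
            (h1 x (hB.1.1 hx)).2 (h.trans_lt ((h2 x (hB.1.1 hx)).1 hx))
        · exact Or.inl fun x hx =>
            (h2 x (hA.1.1 hx)).2 (((h1 x (hA.1.1 hx)).1 hx).trans h)
        · exact Or.inl fun x hx =>
            (h2 x (hA.1.1 hx)).2 (h.trans_lt ((h1 x (hA.1.1 hx)).1 hx))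
        · exact Or.inr fun x hx =>
            (h1 x (hB.1.1 hx)).2 (((h2 x (hB.1.1 hx)).1 hx).trans h)
      apply Subtype.ext
      rcases hcomp with h | h
      · exact Finset.eq_of_subset_of_card_le h (by rw [hA.2, hB.2])
      · exact (Finset.eq_of_subset_of_card_le h (by rw [hA.2, hB.2])).symm
    have := Fintype.card_le_of_injective f hinj
    simpa [mul_comm] using this
  · rw [← Finset.card_powersetCard]
    exact Finset.card_le_card (Finset.filter_subset _ _)

lemma two_mul_partitioningFunction_le {ℓ n : ℕ} (hn : 2 ≤ n) (m : ℕ) :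
    2 * partitioningFunction (decisionStumps ℓ n) 2 m ≤
      ∑ k ∈ Finset.Ico 1 m, min (2 * ℓ) (m.choose k) := by
  have h : partitioningFunction (decisionStumps ℓ n) 2 m ≤
      (∑ k ∈ Finset.Ico 1 m, min (2 * ℓ) (m.choose k)) / 2 := by
    rcases Set.eq_empty_or_nonempty {N : ℕ | ∃ S : Finset (Fin ℓ → ℝ),
      S.card = m ∧ N = (realizablePartitions (decisionStumps ℓ n) 2 S).ncard} with h0 | h0
    · simp only [partitioningFunction, h0, csSup_empty]
      exact bot_le
    · refine csSup_le h0 ?_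
      rintro N ⟨S, rfl, rfl⟩
      rw [Nat.le_div_iff_mul_le two_pos, mul_comm, two_mul_ncard_realizablePartitions hn]
      exact Finset.sum_le_sum fun k _ => card_cuts_le S k
  omega

/-! ### Samples from families of chains -/

/-- A maximal chain of subsets of `α`, with one member `C j` of every size `j ≤ |α|`. The values at
larger indices are constrained by monotonicity only, which makes them all of `α`. -/
structure IsGradedChain {α : Type*} [Fintype α] (C : ℕ → Finset α) : Prop where
  mono : Monotone C
  card_eq : ∀ j ≤ Fintype.card α, (C j).card = j

/-- The sets of size `k` that the chains `C i` cut off: the members of size `k` and the complements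
of the members of size `|α| - k`. -/
def chainCuts {α : Type*} [Fintype α] [DecidableEq α] {ℓ : ℕ} (C : Fin ℓ → ℕ → Finset α) (k : ℕ) :
    Finset (Finset α) :=
  Finset.univ.image (fun i => C i k) ∪
    Finset.univ.image (fun i => (C i (Fintype.card α - k))ᶜ)

section Rank

variable {α : Type*} [Fintype α] [DecidableEq α]

/-- The position at which `p` enters the chain `C`. -/
def chainRank (C : ℕ → Finset α) (p : α) : ℕ :=
  ((Finset.range (Fintype.card α + 1)).filter (fun j => p ∉ C j)).card

lemma chainRank_le_iff {C : ℕ → Finset α} (hC : IsGradedChain C) {j : ℕ}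
    (hj : j ≤ Fintype.card α) (p : α) : chainRank C p ≤ j ↔ p ∈ C j := by
  constructor
  · intro h
    by_contra hp
    have hsub : Finset.range (j + 1) ⊆
        (Finset.range (Fintype.card α + 1)).filter (fun j => p ∉ C j) := by
      intro i hi
      rw [Finset.mem_range] at hi
      simp only [Finset.mem_filter, Finset.mem_range]
      exact ⟨by omega, fun h => hp (hC.mono (by omega : i ≤ j) h)⟩
    have := Finset.card_le_card hsub
    rw [Finset.card_range] at this
    unfold chainRank at h
    omega
  · intro hp
    have hsub : (Finset.range (Fintype.card α + 1)).filter (fun j => p ∉ C j) ⊆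
        Finset.range j := by
      intro i hi
      simp only [Finset.mem_filter, Finset.mem_range] at hi ⊢
      by_contra hij
      exact hi.2 (hC.mono (by omega : j ≤ i) hp)
    simpa [chainRank] using Finset.card_le_card hsub

lemma chainRank_injective {C : ℕ → Finset α} (hC : IsGradedChain C) :
    Function.Injective (chainRank C) := by
  intro p q hpq
  have huniv : C (Fintype.card α) = Finset.univ := by
    rw [← Finset.card_eq_iff_eq_univ, hC.card_eq _ le_rfl]
  have hle : chainRank C p ≤ Fintype.card α := by
    rw [chainRank_le_iff hC le_rfl, huniv]
    exact Finset.mem_univ p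
  have hempty : C 0 = ∅ := Finset.card_eq_zero.1 (hC.card_eq 0 (Nat.zero_le _))
  obtain ⟨c, hc⟩ : ∃ c, chainRank C p = c + 1 := by
    refine Nat.exists_eq_succ_of_ne_zero fun h => ?_
    have := (chainRank_le_iff hC (Nat.zero_le _) p).1 h.le
    simp [hempty] at this
  have hstep : ((C (c + 1)) \ (C c)).card = 1 := by
    rw [Finset.card_sdiff_of_subset (hC.mono (Nat.le_succ c)), hC.card_eq _ (by omega),
      hC.card_eq _ (by omega)]
    omega
  have hmem : ∀ r, chainRank C r = c + 1 → r ∈ C (c + 1) \ C c := by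
    intro r hr
    rw [Finset.mem_sdiff, ← chainRank_le_iff hC (by omega), ← chainRank_le_iff hC (by omega)]
    omega
  obtain ⟨a, ha⟩ := Finset.card_eq_one.1 hstep
  have h1 := hmem p hc
  have h2 := hmem q (hpq ▸ hc)
  rw [ha, Finset.mem_singleton] at h1 h2
  rw [h1, h2]

/-- Using the ranks of the points in `ℓ` maximal chains as the `ℓ` features turns every set of
`chainCuts` into a cut. If each size is cut as often as the upper bound allows, the upper bound is
attained. -/
lemma two_mul_partitioningFunction_eq_of_chains {ℓ n : ℕ} (hn : 2 ≤ n) (hℓ : 0 < ℓ)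
    (C : Fin ℓ → ℕ → Finset α) (hC : ∀ i, IsGradedChain (C i))
    (hcuts : ∀ k ∈ Finset.Ico 1 (Fintype.card α),
      min (2 * ℓ) ((Fintype.card α).choose k) ≤ (chainCuts C k).card) :
    2 * partitioningFunction (decisionStumps ℓ n) 2 (Fintype.card α) =
      ∑ k ∈ Finset.Ico 1 (Fintype.card α), min (2 * ℓ) ((Fintype.card α).choose k) := by
  refine le_antisymm (two_mul_partitioningFunction_le hn _) ?_
  let X : α → Fin ℓ → ℝ := fun p i => chainRank (C i) p
  have hX : Function.Injective X := by
    intro p q h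
    have := congrFun h ⟨0, hℓ⟩
    exact chainRank_injective (hC ⟨0, hℓ⟩) (Nat.cast_injective this)
  let S : Finset (Fin ℓ → ℝ) := Finset.univ.map ⟨X, hX⟩
  have hS : S.card = Fintype.card α := by simp [S]
  have hle : (realizablePartitions (decisionStumps ℓ n) 2 S).ncard ≤
      partitioningFunction (decisionStumps ℓ n) 2 (Fintype.card α) :=
    le_csSup (partitioningFunction_bddAbove _ _ _) ⟨S, hS, rfl⟩
  refine le_trans ?_ (Nat.mul_le_mul_left 2 hle)
  rw [two_mul_ncard_realizablePartitions hn, hS]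
  refine Finset.sum_le_sum fun k hk => (hcuts k hk).trans ?_
  rw [Finset.mem_Ico] at hk
  rw [← Finset.card_map (Finset.mapEmbedding ⟨X, hX⟩).toEmbedding (s := chainCuts C k)]
  refine Finset.card_le_card fun B hB => ?_
  obtain ⟨A, hA, rfl⟩ := Finset.mem_map.1 hB
  have hsub : A.map ⟨X, hX⟩ ⊆ S := Finset.map_subset_map.2 (Finset.subset_univ A)
  simp only [chainCuts, Finset.mem_union, Finset.mem_image, Finset.mem_univ, true_and] at hA
  rw [RelEmbedding.coe_toEmbedding, Finset.mapEmbedding_apply, mem_cuts, Finset.card_map]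
  rcases hA with ⟨i, rfl⟩ | ⟨i, rfl⟩
  · refine ⟨⟨hsub, i, k, Or.inl ?_⟩, (hC i).card_eq k hk.2.le⟩
    intro x hx
    obtain ⟨p, -, rfl⟩ := Finset.mem_map.1 hx
    rw [Finset.mem_map' ⟨X, hX⟩, ← chainRank_le_iff (hC i) hk.2.le]
    simp [X]
  · refine ⟨⟨hsub, i, (Fintype.card α - k : ℕ), Or.inr ?_⟩, ?_⟩
    · intro x hx
      obtain ⟨p, -, rfl⟩ := Finset.mem_map.1 hx
      rw [Finset.mem_map' ⟨X, hX⟩, Finset.mem_compl,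
        ← chainRank_le_iff (hC i) (Nat.sub_le _ _), not_le]
      exact Nat.cast_lt.symm
    · rw [Finset.card_compl, (hC i).card_eq _ (Nat.sub_le _ _)]
      omega

end Rank

/-! ### Few features: cyclic intervals -/

/-- The cyclic interval of length `k` that starts at `s`. -/
noncomputable def cycInterval (m : ℕ) (s : ℤ) (k : ℕ) : Finset (ZMod m) :=
  (Finset.Ico s (s + k)).image (fun z : ℤ => (z : ZMod m))

lemma mem_cycInterval {m : ℕ} {s : ℤ} {k : ℕ} {z : ℤ} :
    (z : ZMod m) ∈ cycInterval m s k ↔ ∃ y, s ≤ y ∧ y < s + k ∧ (m : ℤ) ∣ y - z := by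
  simp only [cycInterval, Finset.mem_image, Finset.mem_Ico, and_assoc]
  refine exists_congr fun y => and_congr_right fun _ => and_congr_right fun _ => ?_
  rw [ZMod.intCast_eq_intCast_iff, Int.modEq_comm, Int.modEq_iff_dvd]

lemma eq_of_dvd_of_abs_lt {m a b : ℤ} (h : m ∣ a - b) (h1 : a - b < m) (h2 : b - a < m) :
    a = b := by
  have := Int.eq_zero_of_abs_lt_dvd h (by rw [abs_lt]; omega)
  omega

lemma card_cycInterval {m : ℕ} (s : ℤ) {k : ℕ} (hk : k ≤ m) : (cycInterval m s k).card = k := by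
  rw [cycInterval, Finset.card_image_of_injOn, Int.card_Ico]
  · simp
  · intro a ha b hb hab
    rw [Finset.coe_Ico, Set.mem_Ico] at ha hb
    change (a : ZMod m) = (b : ZMod m) at hab
    rw [ZMod.intCast_eq_intCast_iff, Int.modEq_comm, Int.modEq_iff_dvd] at hab
    exact eq_of_dvd_of_abs_lt hab (by omega) (by omega)

lemma cycInterval_mono {m : ℕ} {s s' : ℤ} {k k' : ℕ} (h : s' ≤ s) (h' : s + k ≤ s' + k') :
    cycInterval m s k ⊆ cycInterval m s' k' :=
  Finset.image_subset_image (Finset.Ico_subset_Ico h h')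

lemma compl_cycInterval {m : ℕ} [NeZero m] (s : ℤ) {k : ℕ} (hk : k ≤ m) :
    (cycInterval m s k)ᶜ = cycInterval m (s + k) (m - k) := by
  refine (Finset.eq_of_subset_of_card_le ?_ ?_).symm
  · intro x hx
    obtain ⟨z, rfl⟩ := ZMod.intCast_surjective x
    rw [Finset.mem_compl, mem_cycInterval]
    rw [mem_cycInterval] at hx
    rintro ⟨y, h1, h2, h3⟩
    obtain ⟨x, h4, h5, h6⟩ := hx
    have hd : (m : ℤ) ∣ x - y := by
      have := dvd_sub h6 h3
      rwa [sub_sub_sub_cancel_right] at this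
    have := eq_of_dvd_of_abs_lt hd (by omega) (by omega)
    omega
  · rw [Finset.card_compl, card_cycInterval s hk, card_cycInterval _ (Nat.sub_le m k), ZMod.card]

/-- A proper cyclic interval determines its starting point: it is the only member whose predecessor
is not a member. -/
lemma dvd_of_cycInterval_eq {m : ℕ} {s s' : ℤ} {k : ℕ} (h0 : 0 < k) (hk : k < m)
    (h : cycInterval m s k = cycInterval m s' k) : (m : ℤ) ∣ s - s' := by
  have h1 : (s : ZMod m) ∈ cycInterval m s' k := by
    rw [← h, mem_cycInterval]
    exact ⟨s, le_rfl, by omega, by simp⟩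
  have h2 : ((s - 1 : ℤ) : ZMod m) ∉ cycInterval m s' k := by
    rw [← h, mem_cycInterval]
    rintro ⟨y, h1, h2, h3⟩
    have := eq_of_dvd_of_abs_lt h3 (by omega) (by omega)
    omega
  obtain ⟨y, hy1, hy2, hy3⟩ := mem_cycInterval.1 h1
  rcases hy1.eq_or_lt with rfl | hlt
  · rw [← dvd_neg]
    simpa using hy3
  · refine absurd (mem_cycInterval.2 ⟨y - 1, by omega, by omega, ?_⟩) h2
    simpa using hy3

/-- The intervals that grow from the point `i` of the cycle alternately to the right and to the
left. -/
noncomputable def cycChain (m : ℕ) (i : ℕ) (j : ℕ) : Finset (ZMod m) :=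
  cycInterval m (i - (j / 2 : ℕ)) j

lemma isGradedChain_cycChain (m : ℕ) [NeZero m] (i : ℕ) : IsGradedChain (cycChain m i) where
  mono := by
    intro j j' h
    have : j / 2 ≤ j' / 2 := Nat.div_le_div_right h
    exact cycInterval_mono (by omega) (by omega)
  card_eq := by
    intro j hj
    rw [ZMod.card] at hj
    exact card_cycInterval _ hj

/-- The complement of a cyclic interval centred at `i` is centred at the antipode of `i`. Hence the
chains of at most `m / 2` consecutive centres and their complements are distinct at every level. -/
lemma le_card_chainCuts_cycChain {ℓ m : ℕ} [NeZero m] (h : 2 * ℓ ≤ m) {k : ℕ} (h0 : 0 < k)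
    (hk : k < m) : 2 * ℓ ≤ (chainCuts (fun i : Fin ℓ => cycChain m i) k).card := by
  have hcompl : ∀ i : ℕ, (cycChain m i (m - k))ᶜ =
      cycInterval m (i - ((m - k) / 2 : ℕ) + (m - k : ℕ)) k := by
    intro i
    rw [cycChain, compl_cycInterval _ (Nat.sub_le m k), Nat.sub_sub_self hk.le]
  rw [chainCuts, Finset.card_union_of_disjoint, Finset.card_image_of_injective,
    Finset.card_image_of_injective, Finset.card_univ, Fintype.card_fin, two_mul]
  · intro i j hij
    simp only [ZMod.card, hcompl] at hij
    have := eq_of_dvd_of_abs_lt (dvd_of_cycInterval_eq h0 hk hij) (by omega) (by omega)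
    ext
    omega
  · intro i j hij
    have := eq_of_dvd_of_abs_lt (dvd_of_cycInterval_eq h0 hk hij) (by omega) (by omega)
    ext
    omega
  · refine Finset.disjoint_left.2 fun A hA hB => ?_
    obtain ⟨i, -, rfl⟩ := Finset.mem_image.1 hA
    obtain ⟨j, -, hj⟩ := Finset.mem_image.1 hB
    rw [ZMod.card, hcompl] at hj
    have := eq_of_dvd_of_abs_lt (dvd_of_cycInterval_eq h0 hk hj) (by omega) (by omega)
    omega

lemma two_mul_partitioningFunction_eq_of_two_mul_le {ℓ n m : ℕ} (hn : 2 ≤ n) (hℓ : 0 < ℓ)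
    (h : 2 * ℓ ≤ m) : 2 * partitioningFunction (decisionStumps ℓ n) 2 m =
      ∑ k ∈ Finset.Ico 1 m, min (2 * ℓ) (m.choose k) := by
  have : NeZero m := ⟨by omega⟩
  have := two_mul_partitioningFunction_eq_of_chains (α := ZMod m) hn hℓ
    (fun i : Fin ℓ => cycChain m i) (fun i => isGradedChain_cycChain m i) (fun k hk => by
      rw [Finset.mem_Ico, ZMod.card] at hk
      exact (min_le_left _ _).trans (le_card_chainCuts_cycChain h hk.1 hk.2))
  rwa [ZMod.card] at this

/-! ### Near-perfect matchings in connected vertex-transitive graphs -/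

/-- A matching of `G`, encoded as the involution that swaps the ends of every matched edge and
fixes the unmatched vertices. -/
def IsMatchingInvolution {V : Type*} (G : SimpleGraph V) (f : Equiv.Perm V) : Prop :=
  ∀ v, f (f v) = v ∧ (f v = v ∨ G.Adj v (f v))

section Gallai

variable {V : Type*}

/-- The matching that agrees with `g` on a set of vertices closed under both matchings and with `f`
off it. -/
def glue (P : V → Prop) [DecidablePred P] (f g : Equiv.Perm V) (hf : ∀ v, f (f v) = v)
    (hg : ∀ v, g (g v) = v) (hfP : ∀ v, P (f v) ↔ P v) (hgP : ∀ v, P (g v) ↔ P v) :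
    Equiv.Perm V :=
  Function.Involutive.toPerm (fun v => if P v then g v else f v) (by
    intro v
    by_cases h : P v <;> simp [h, hf, hg, hfP, hgP])

/-- Two involutions `f` and `g` generate a dihedral group. If `g` fixes `t`, then the orbit of `t` is
`{(f * g) ^ i t}`, and `g` acts on the exponents `i` as the reflection `i ↦ -i`. -/
lemma apply_right_zpow {f g : Equiv.Perm V} (hf : ∀ v, f (f v) = v)
    (hg : ∀ v, g (g v) = v) {t : V} (ht : g t = t) (i : ℤ) :
    g (((f * g) ^ i) t) = ((f * g) ^ (-i)) t := by
  have hg' : g⁻¹ = g := inv_eq_of_mul_eq_one_left (Equiv.ext hg)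
  have hf' : f⁻¹ = f := inv_eq_of_mul_eq_one_left (Equiv.ext hf)
  have hconj : g * (f * g) * g⁻¹ = (f * g)⁻¹ := by
    rw [mul_inv_rev, hg', hf', mul_assoc, mul_assoc, show g * g = 1 from Equiv.ext hg, mul_one]
  have h := congrArg (fun e : Equiv.Perm V => e t) (conj_zpow (i := i) (a := g) (b := f * g))
  rw [hconj, inv_zpow'] at h
  simpa [hg', ht] using h.symm

/-- On the same orbit, `f` acts on the exponents as the reflection `i ↦ 1 - i`. -/
lemma apply_left_zpow {f g : Equiv.Perm V} (hf : ∀ v, f (f v) = v)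
    (hg : ∀ v, g (g v) = v) {t : V} (ht : g t = t) (i : ℤ) :
    f (((f * g) ^ i) t) = ((f * g) ^ (1 - i)) t := by
  rw [sub_eq_add_neg, zpow_add, zpow_one, Equiv.Perm.mul_apply,
    ← apply_right_zpow hf hg ht, Equiv.Perm.mul_apply, hg]

/-- In the orbit of a vertex `t` unmatched by `g` under the group generated by two matchings `f`
and `g`, at most one vertex is unmatched by `f`: the orbit is an alternating path with end `t`. -/
lemma eq_of_fixed_in_orbit {f g : Equiv.Perm V} (hf : ∀ v, f (f v) = v) (hg : ∀ v, g (g v) = v)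
    {t : V} (ht : g t = t) {i j : ℤ} (hi : f (((f * g) ^ i) t) = ((f * g) ^ i) t)
    (hj : f (((f * g) ^ j) t) = ((f * g) ^ j) t) : ((f * g) ^ i) t = ((f * g) ^ j) t := by
  have hmem : ∀ i : ℤ, f (((f * g) ^ i) t) = ((f * g) ^ i) t →
      (f * g) ^ (1 - 2 * i) ∈ MulAction.stabilizer (Equiv.Perm V) t := by
    intro i hi
    rw [apply_left_zpow hf hg ht] at hi
    rw [MulAction.mem_stabilizer_iff, Equiv.Perm.smul_def,
      show 1 - 2 * i = -i + (1 - i) by ring, zpow_add, Equiv.Perm.mul_apply, hi,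
      ← Equiv.Perm.mul_apply, ← zpow_add, neg_add_cancel, zpow_zero, Equiv.Perm.one_apply]
  -- The period of `t` under `f * g` divides the odd number `1 - 2 * i` and also `2 * (j - i)`.
  have hodd := hmem i hi
  have heven : (f * g) ^ (2 * (j - i)) ∈ MulAction.stabilizer (Equiv.Perm V) t := by
    have := mul_mem hodd (inv_mem (hmem j hj))
    rwa [← zpow_neg, ← zpow_add, show 1 - 2 * i + -(1 - 2 * j) = 2 * (j - i) by ring] at this
  have hd : (f * g) ^ (j - i) ∈ MulAction.stabilizer (Equiv.Perm V) t := by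
    have := mul_mem (zpow_mem hodd (j - i)) (zpow_mem heven i)
    rwa [← zpow_mul, ← zpow_mul, ← zpow_add,
      show (1 - 2 * i) * (j - i) + 2 * (j - i) * i = j - i by ring] at this
  rw [MulAction.mem_stabilizer_iff, Equiv.Perm.smul_def] at hd
  rw [show j = i + (j - i) by ring, zpow_add, Equiv.Perm.mul_apply, hd]

variable [Fintype V] [DecidableEq V]

/-- The number of vertices that a matching leaves unmatched. -/
def numFixed (f : Equiv.Perm V) : ℕ := (Finset.univ.filter fun v => f v = v).card

/-- A matching with the fewest unmatched vertices. -/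
def IsMaxMatching (G : SimpleGraph V) (f : Equiv.Perm V) : Prop :=
  IsMatchingInvolution G f ∧ ∀ g, IsMatchingInvolution G g → numFixed f ≤ numFixed g

lemma exists_isMaxMatching (G : SimpleGraph V) : ∃ f, IsMaxMatching G f := by
  classical
  obtain ⟨f, hf, hmin⟩ := Finset.exists_min_image
    (Finset.univ.filter fun f : Equiv.Perm V => IsMatchingInvolution G f) numFixed
    ⟨1, Finset.mem_filter.2 ⟨Finset.mem_univ _, fun v => ⟨rfl, Or.inl rfl⟩⟩⟩
  exact ⟨f, (Finset.mem_filter.1 hf).2, fun g hg => hmin g (by simpa using hg)⟩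

/-- Exchanging two maximum matchings on a set closed under both leaves them maximum: what one of
them gains the other one loses. -/
lemma isMaxMatching_glue {G : SimpleGraph V} {f g : Equiv.Perm V} (hf : IsMaxMatching G f)
    (hg : IsMaxMatching G g) (P : V → Prop) [DecidablePred P] (hfP : ∀ v, P (f v) ↔ P v)
    (hgP : ∀ v, P (g v) ↔ P v) :
    IsMaxMatching G (glue P f g (fun v => (hf.1 v).1) (fun v => (hg.1 v).1) hfP hgP) := by
  have hmatch : ∀ (f g : Equiv.Perm V) (hf : IsMaxMatching G f) (hg : IsMaxMatching G g)
      (hfP : ∀ v, P (f v) ↔ P v) (hgP : ∀ v, P (g v) ↔ P v), IsMatchingInvolution G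
      (glue P f g (fun v => (hf.1 v).1) (fun v => (hg.1 v).1) hfP hgP) := by
    intro f g hf hg hfP hgP v
    refine ⟨Function.Involutive.toPerm_involutive _ v, ?_⟩
    change (if P v then g v else f v) = v ∨ G.Adj v (if P v then g v else f v)
    split_ifs
    · exact (hg.1 v).2
    · exact (hf.1 v).2
  have hcount : ∀ (f g : Equiv.Perm V) (hf : IsMaxMatching G f) (hg : IsMaxMatching G g)
      (hfP : ∀ v, P (f v) ↔ P v) (hgP : ∀ v, P (g v) ↔ P v), numFixed
      (glue P f g (fun v => (hf.1 v).1) (fun v => (hg.1 v).1) hfP hgP) =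
      (Finset.univ.filter fun v => P v ∧ g v = v).card +
        (Finset.univ.filter fun v => ¬ P v ∧ f v = v).card := by
    intro f g hf hg hfP hgP
    rw [numFixed, ← Finset.card_filter_add_card_filter_not (fun v => P v), Finset.filter_filter,
      Finset.filter_filter]
    have hg' : ∀ v, glue P f g (fun v => (hf.1 v).1) (fun v => (hg.1 v).1) hfP hgP v =
        if P v then g v else f v := fun _ => rfl
    congr 2 <;> ext v <;> rw [Finset.mem_filter, Finset.mem_filter, hg'] <;>
      by_cases h : P v <;> simp [h]
  have hsplit : ∀ f : Equiv.Perm V, numFixed f =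
      (Finset.univ.filter fun v => P v ∧ f v = v).card +
        (Finset.univ.filter fun v => ¬ P v ∧ f v = v).card := by
    intro f
    rw [numFixed, ← Finset.card_filter_add_card_filter_not (fun v => P v), Finset.filter_filter,
      Finset.filter_filter]
    congr 2 <;> ext v <;> by_cases h : P v <;> simp [h]
  refine ⟨hmatch f g hf hg hfP hgP, fun e he => le_trans ?_ (hf.2 e he)⟩
  have h := hg.2 _ (hmatch g f hg hf hgP hfP)
  rw [hcount g f hg hf hgP hfP, hsplit g] at h
  rw [hcount f g hf hg hfP hgP, hsplit f]
  omega

/-- Gallai's exchange argument: if some maximum matching misses `t`, and no maximum matching misses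
both `u` and `t` or both `t` and `v`, then none misses both `u` and `v`. -/
lemma not_both_fixed_trans {G : SimpleGraph V} {u t v : V}
    (ht : ∃ g, IsMaxMatching G g ∧ g t = t)
    (hut : ∀ f, IsMaxMatching G f → f u = u → f t = t → u = t)
    (htv : ∀ f, IsMaxMatching G f → f t = t → f v = v → t = v) :
    ∀ f, IsMaxMatching G f → f u = u → f v = v → u = v := by
  classical
  intro f hf hu hv
  obtain ⟨g, hg, hgt⟩ := ht
  have hff := fun v => (hf.1 v).1
  have hgg := fun v => (hg.1 v).1
  -- The orbit of `t` contains at most one of `u` and `v`. Exchanging `f` for `g` on it yields a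
  -- maximum matching that misses `t` together with the other one.
  let P : V → Prop := fun w => ∃ i : ℤ, ((f * g) ^ i) t = w
  have hfP' : ∀ w, P w → P (f w) := by
    rintro _ ⟨i, rfl⟩
    exact ⟨1 - i, (apply_left_zpow hff hgg hgt i).symm⟩
  have hgP' : ∀ w, P w → P (g w) := by
    rintro _ ⟨i, rfl⟩
    exact ⟨-i, (apply_right_zpow hff hgg hgt i).symm⟩
  have hfP : ∀ w, P (f w) ↔ P w := fun w => ⟨fun h => by simpa [hff] using hfP' _ h, hfP' w⟩
  have hgP : ∀ w, P (g w) ↔ P w := fun w => ⟨fun h => by simpa [hgg] using hgP' _ h, hgP' w⟩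
  have hmax := isMaxMatching_glue hf hg P hfP hgP
  have hPt : P t := ⟨0, by simp⟩
  have hglue : ∀ w, glue P f g hff hgg hfP hgP w = if P w then g w else f w := fun _ => rfl
  by_cases hPu : P u
  · by_cases hPv : P v
    · obtain ⟨i, rfl⟩ := hPu
      obtain ⟨j, rfl⟩ := hPv
      exact eq_of_fixed_in_orbit hff hgg hgt hu hv
    · have := htv _ hmax (by simp [hglue, hPt, hgt]) (by simp [hglue, hPv, hv])
      exact absurd (this ▸ hPt) hPv
  · have := hut _ hmax (by simp [hglue, hPu, hu]) (by simp [hglue, hPt, hgt])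
    exact absurd (this ▸ hPt) hPu

/-- A connected vertex-transitive graph has a matching missing at most one vertex. If no maximum
matching misses a vertex there is nothing to show. Otherwise every vertex is missed by some maximum
matching, by transitivity, and Gallai's argument applies: no maximum matching misses two adjacent
vertices, and this propagates along paths. -/
theorem exists_near_perfect_matching (G : SimpleGraph V) (hG : G.Preconnected)
    (htrans : ∀ u v, ∃ e : G ≃g G, e u = v) :
    ∃ f, IsMatchingInvolution G f ∧ ∀ u v, f u = u → f v = v → u = v := by
  by_cases hall : ∃ f, IsMaxMatching G f ∧ ∃ v, f v = v
  swap
  · push Not at hall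
    obtain ⟨f, hf⟩ := exists_isMaxMatching G
    exact ⟨f, hf.1, fun u _ hu => absurd hu (hall f hf u)⟩
  obtain ⟨f, hf, w, hw⟩ := hall
  have hmiss : ∀ t, ∃ g, IsMaxMatching G g ∧ g t = t := by
    intro t
    obtain ⟨e, he⟩ := htrans w t
    have hew : e.toEquiv.symm t = w := by rw [← he]; exact e.toEquiv.symm_apply_apply w
    refine ⟨(e.toEquiv.symm.trans f).trans e.toEquiv, ⟨fun v => ?_, fun g hg => ?_⟩, ?_⟩
    · simp only [Equiv.trans_apply, Equiv.symm_apply_apply, (hf.1 _).1, Equiv.apply_symm_apply,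
        true_and]
      rcases (hf.1 (e.toEquiv.symm v)).2 with h | h
      · left; rw [h, Equiv.apply_symm_apply]
      · right
        have := e.map_adj_iff.2 h
        rwa [show e (e.toEquiv.symm v) = v from e.toEquiv.apply_symm_apply v] at this
    · refine le_trans (le_of_eq ?_) (hf.2 g hg)
      refine Finset.card_bij' (fun v _ => e.toEquiv.symm v) (fun v _ => e.toEquiv v) ?_ ?_ ?_ ?_
      · intro v hv
        rw [Finset.mem_filter] at hv ⊢
        refine ⟨Finset.mem_univ _, ?_⟩
        rw [Equiv.eq_symm_apply]
        exact hv.2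
      · intro v hv
        rw [Finset.mem_filter] at hv ⊢
        refine ⟨Finset.mem_univ _, ?_⟩
        simp only [Equiv.trans_apply, Equiv.symm_apply_apply, hv.2]
      · exact fun v _ => e.toEquiv.apply_symm_apply v
      · exact fun v _ => e.toEquiv.symm_apply_apply v
    · simp only [Equiv.trans_apply, hew, hw]
      exact he
  have key : ∀ u v, ∀ f, IsMaxMatching G f → f u = u → f v = v → u = v := by
    intro u v
    obtain ⟨p⟩ := hG u v
    induction p with
    | nil => exact fun _ _ _ _ => rfl
    | @cons u t v hadj _ ih =>
      refine not_both_fixed_trans (hmiss t) ?_ ih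
      -- Adding the edge `u t` to a matching that misses both ends would improve it.
      intro f hf hu ht
      by_contra hut
      have hsupp : ∀ x, x ≠ u → x ≠ t → f x ≠ u ∧ f x ≠ t := fun x h1 h2 =>
        ⟨fun h => h1 (f.injective (h.trans hu.symm)), fun h => h2 (f.injective (h.trans ht.symm))⟩
      have happ : ∀ x, x ≠ u → x ≠ t → (f * Equiv.swap u t) x = f x := fun x h1 h2 => by
        rw [Equiv.Perm.mul_apply, Equiv.swap_apply_of_ne_of_ne h1 h2]
      have h1 : (f * Equiv.swap u t) u = t := by simp [ht]
      have h2 : (f * Equiv.swap u t) t = u := by simp [hu]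
      have hm : IsMatchingInvolution G (f * Equiv.swap u t) := by
        intro x
        by_cases hxu : x = u
        · rw [hxu, h1, h2]
          exact ⟨rfl, Or.inr hadj⟩
        by_cases hxt : x = t
        · rw [hxt, h2, h1]
          exact ⟨rfl, Or.inr hadj.symm⟩
        · obtain ⟨h3, h4⟩ := hsupp x hxu hxt
          rw [happ x hxu hxt, happ _ h3 h4]
          exact hf.1 x
      have hlt : numFixed (f * Equiv.swap u t) < numFixed f := by
        refine Finset.card_lt_card ⟨?_, fun hsub => ?_⟩
        · intro x hx
          rw [Finset.mem_filter] at hx ⊢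
          refine ⟨Finset.mem_univ _, ?_⟩
          by_cases hxu : x = u
          · rw [hxu, hu]
          by_cases hxt : x = t
          · rw [hxt, ht]
          rw [← happ x hxu hxt, hx.2]
        · have := hsub (Finset.mem_filter.2 ⟨Finset.mem_univ u, hu⟩)
          rw [Finset.mem_filter, h1] at this
          exact hut this.2.symm
      exact absurd (hf.2 _ hm) (not_le.2 hlt)
  exact ⟨f, hf.1, fun u v hu hv => key u v f hf hu hv⟩

end Gallai

/-! ### Pairs of disjoint sets of half the size -/

section DisjointPairs

variable {α : Type*} [Fintype α] [DecidableEq α]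

/-- The Kneser graph: the sets of size `r`, adjacent when disjoint. The first condition in `Adj`
excludes the loop at the empty set. -/
def kneserGraph (α : Type*) [Fintype α] [DecidableEq α] (r : ℕ) :
    SimpleGraph {A : Finset α // A.card = r} where
  Adj A B := A ≠ B ∧ Disjoint A.1 B.1
  symm := ⟨fun _ _ h => ⟨h.1.symm, h.2.symm⟩⟩
  loopless := ⟨fun _ h => h.1 rfl⟩

lemma kneserGraph_transitive (r : ℕ) (A B : {A : Finset α // A.card = r}) :
    ∃ e : kneserGraph α r ≃g kneserGraph α r, e A = B := by
  have hcard : Fintype.card {x // x ∈ A.1} = Fintype.card {x // x ∈ B.1} := by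
    simp [A.2, B.2]
  let σ : Equiv.Perm α := (Fintype.equivOfCardEq hcard).extendSubtype
  have hσ : A.1.map σ.toEmbedding = B.1 := by
    refine Finset.eq_of_subset_of_card_le ?_ (by rw [Finset.card_map, A.2, B.2])
    intro y hy
    obtain ⟨x, hx, rfl⟩ := Finset.mem_map.1 hy
    exact Equiv.extendSubtype_mem _ x hx
  refine ⟨⟨(Equiv.finsetCongr σ).subtypeEquiv (fun X => by simp), ?_⟩, ?_⟩
  · intro X Y
    simp [kneserGraph, Subtype.ext_iff]
  · apply Subtype.ext
    simpa using hσ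

/-- Two sets that differ by exchanging one element have a common neighbour in the odd graph. -/
lemma kneserGraph_preconnected {r : ℕ} (h : Fintype.card α = 2 * r + 1) :
    (kneserGraph α r).Preconnected := by
  intro A B
  induction hd : (A.1 \ B.1).card using Nat.strong_induction_on generalizing A with
  | _ d ih =>
    by_cases hAB : A = B
    · rw [hAB]
    have hsub : ¬ A.1 ⊆ B.1 := fun hs =>
      hAB (Subtype.ext (Finset.eq_of_subset_of_card_le hs (by rw [A.2, B.2])))
    have hsub' : ¬ B.1 ⊆ A.1 := fun hs =>
      hAB (Subtype.ext (Finset.eq_of_subset_of_card_le hs (by rw [A.2, B.2])).symm)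
    obtain ⟨a, ha, haB⟩ := Finset.not_subset.1 hsub
    obtain ⟨b, hb, hbA⟩ := Finset.not_subset.1 hsub'
    have hr : 0 < r := A.2 ▸ Finset.card_pos.2 ⟨a, ha⟩
    have hA' : (insert b (A.1.erase a)).card = r := by
      rw [Finset.card_insert_of_notMem (fun h => hbA (Finset.mem_of_mem_erase h)),
        Finset.card_erase_of_mem ha, A.2]
      omega
    have hC : (insert b A.1)ᶜ.card = r := by
      rw [Finset.card_compl, Finset.card_insert_of_notMem hbA, A.2, h]
      omega
    have hadj : ∀ X : {A : Finset α // A.card = r}, X.1 ⊆ insert b A.1 →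
        (kneserGraph α r).Adj X ⟨_, hC⟩ := by
      intro X hX
      have hdisj : Disjoint X.1 (insert b A.1)ᶜ :=
        Disjoint.mono_left hX disjoint_compl_right
      refine ⟨fun hXC => ?_, hdisj⟩
      rw [← show X.1 = (insert b A.1)ᶜ from congrArg Subtype.val hXC, disjoint_self,
        Finset.bot_eq_empty, ← Finset.card_eq_zero, X.2] at hdisj
      omega
    have hadj' := hadj ⟨_, hA'⟩ (Finset.insert_subset_insert _ (Finset.erase_subset _ _))
    refine ((hadj A (Finset.subset_insert _ _)).reachable.trans hadj'.reachable.symm).trans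
      (ih _ ?_ _ rfl)
    rw [← hd]
    refine Finset.card_lt_card ⟨?_, fun hs => ?_⟩
    · intro x hx
      simp only [Finset.mem_sdiff, Finset.mem_insert, Finset.mem_erase] at hx ⊢
      rcases hx with ⟨rfl | hx, hxB⟩
      · exact absurd hb hxB
      · exact ⟨hx.2, hxB⟩
    · have := hs (Finset.mem_sdiff.2 ⟨ha, haB⟩)
      simp only [Finset.mem_sdiff, Finset.mem_insert, Finset.mem_erase] at this
      rcases this with ⟨rfl | hx, -⟩
      · exact hbA ha
      · exact hx.1 rfl

/-- The sets of half the size can be paired up disjointly, up to one set: by complementation if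
`|α|` is even, and by a near-perfect matching in the odd graph if `|α|` is odd. -/
lemma exists_near_perfect_matching_half :
    ∃ f, IsMatchingInvolution (kneserGraph α (Fintype.card α / 2)) f ∧
      ∀ u v, f u = u → f v = v → u = v := by
  rcases Nat.even_or_odd' (Fintype.card α) with ⟨r, hr | hr⟩
  · have hr' : Fintype.card α / 2 = r := by omega
    have hinv : Function.Involutive (fun A : {A : Finset α // A.card = Fintype.card α / 2} =>
        (⟨A.1ᶜ, by rw [Finset.card_compl, A.2]; omega⟩ :
          {A : Finset α // A.card = Fintype.card α / 2})) := fun A => by simp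
    have hfix : ∀ A, A = hinv.toPerm _ A → A.1 = ∅ := by
      intro A hA
      have h1 : A.1 = A.1ᶜ := congrArg Subtype.val hA
      have h2 : Disjoint A.1 A.1ᶜ := disjoint_compl_right
      rw [← h1] at h2
      simpa using h2
    refine ⟨hinv.toPerm _, fun A => ⟨hinv A, ?_⟩, fun u v hu hv => ?_⟩
    · refine or_iff_not_imp_left.2 fun h => ⟨fun h' => h h'.symm, disjoint_compl_right⟩
    · exact Subtype.ext ((hfix u hu.symm).trans (hfix v hv.symm).symm)
  · have hr' : Fintype.card α / 2 = r := by omega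
    rw [hr']
    exact exists_near_perfect_matching _ (kneserGraph_preconnected hr) (kneserGraph_transitive r)

/-- Representatives of the orbits of a matching with at most one unmatched vertex number about
half of the vertices. -/
lemma exists_cover_of_involution {V : Type*} [Fintype V] [DecidableEq V] [Nonempty V]
    (f : V → V) (hf : ∀ v, f (f v) = v) (hfix : ∀ u v, f u = u → f v = v → u = v) {ℓ : ℕ}
    (hℓ : Fintype.card V ≤ 2 * ℓ) : ∃ a : Fin ℓ → V, ∀ v, ∃ i, v = a i ∨ v = f (a i) := by
  classical
  let e := Fintype.equivFin V
  let T : Finset V := Finset.univ.filter fun v => e v ≤ e (f v)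
  let T' : Finset V := Finset.univ.filter fun v => e (f v) ≤ e v
  have hT : T.card = T'.card := by
    refine Finset.card_bij' (fun v _ => f v) (fun v _ => f v) ?_ ?_ ?_ ?_ <;> simp [T, T', hf]
  have hint : (T ∩ T').card ≤ 1 := by
    refine Finset.card_le_one.2 fun u hu v hv => hfix u v ?_ ?_
    · simp only [T, T', Finset.mem_inter, Finset.mem_filter, Finset.mem_univ, true_and] at hu
      exact e.injective (le_antisymm hu.2 hu.1)
    · simp only [T, T', Finset.mem_inter, Finset.mem_filter, Finset.mem_univ, true_and] at hv
      exact e.injective (le_antisymm hv.2 hv.1)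
  have hunion : T ∪ T' = Finset.univ := by
    ext v
    simpa [T, T'] using le_total (e v) (e (f v))
  have hcard := Finset.card_union_add_card_inter T T'
  rw [hunion, Finset.card_univ] at hcard
  have hTℓ : T.card ≤ ℓ := by omega
  have hpos : 0 < Fintype.card V := Fintype.card_pos
  have : Nonempty T := (Finset.card_pos.1 (by omega)).to_subtype
  obtain ⟨g⟩ : Nonempty (T ↪ Fin ℓ) := by
    rw [Function.Embedding.nonempty_iff_card_le]
    simpa using hTℓ
  have hg := Function.invFun_surjective g.injective
  refine ⟨fun i => (Function.invFun g i).1, fun v => ?_⟩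
  rcases le_total (e v) (e (f v)) with h | h
  · obtain ⟨i, hi⟩ := hg ⟨v, Finset.mem_filter.2 ⟨Finset.mem_univ _, h⟩⟩
    exact ⟨i, Or.inl (by simp [hi])⟩
  · obtain ⟨i, hi⟩ := hg ⟨f v, Finset.mem_filter.2 ⟨Finset.mem_univ _, by rwa [hf]⟩⟩
    exact ⟨i, Or.inr (by simp [hi, hf])⟩

lemma exists_disjoint_pairs {ℓ : ℕ}
    (hℓ : (Fintype.card α).choose (Fintype.card α / 2) ≤ 2 * ℓ) :
    ∃ A B : Fin ℓ → Finset α, (∀ i, (A i).card = Fintype.card α / 2) ∧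
      (∀ i, (B i).card = Fintype.card α / 2) ∧ (∀ i, Disjoint (A i) (B i)) ∧
      ∀ X : Finset α, X.card = Fintype.card α / 2 → ∃ i, X = A i ∨ X = B i := by
  set r := Fintype.card α / 2 with hr
  obtain ⟨f, hf, hfix⟩ := exists_near_perfect_matching_half (α := α)
  have : Nonempty {A : Finset α // A.card = r} := by
    obtain ⟨s, -, hs⟩ := Finset.exists_subset_card_eq
      (s := (Finset.univ : Finset α)) (n := r) (by rw [Finset.card_univ]; omega)
    exact ⟨⟨s, hs⟩⟩
  obtain ⟨a, ha⟩ := exists_cover_of_involution f (fun v => (hf v).1) hfix (ℓ := ℓ)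
    (by rwa [Fintype.card_finset_len])
  -- An unmatched set is paired with any set of the same size in its complement.
  have hpart : ∀ v : {A : Finset α // A.card = r}, ∃ B : Finset α, B.card = r ∧ Disjoint v.1 B ∧
      (f v ≠ v → B = (f v).1) := by
    intro v
    rcases (hf v).2 with h | h
    · obtain ⟨B, hB, hBr⟩ := Finset.exists_subset_card_eq (s := v.1ᶜ) (n := r)
        (by rw [Finset.card_compl, v.2]; omega)
      exact ⟨B, hBr, disjoint_compl_right.mono_right hB, fun h' => absurd h h'⟩
    · exact ⟨(f v).1, (f v).2, h.2, fun _ => rfl⟩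
  choose b hb1 hb2 hb3 using hpart
  refine ⟨fun i => (a i).1, fun i => b (a i), fun i => (a i).2, fun i => hb1 _, fun i => hb2 _,
    fun X hX => ?_⟩
  obtain ⟨i, hi | hi⟩ := ha ⟨X, hX⟩
  · exact ⟨i, Or.inl (congrArg Subtype.val hi)⟩
  · by_cases h : f (a i) = a i
    · rw [h] at hi
      exact ⟨i, Or.inl (congrArg Subtype.val hi)⟩
    · refine ⟨i, Or.inr ?_⟩
      exact (congrArg Subtype.val hi).trans (hb3 _ h).symm

/-! ### Chains below the sets of half the size -/

/-- Below the middle, each level of the Boolean lattice can be matched into the next one: every set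
has at least as many upper as lower covers there, so Hall's condition holds. -/
lemma exists_injective_upward {j : ℕ} (hj : 2 * j < Fintype.card α) :
    ∃ φ : {X : Finset α // X.card = j} → Finset α, Function.Injective φ ∧
      ∀ X, X.1 ⊆ φ X ∧ (φ X).card = j + 1 := by
  classical
  let t : {X : Finset α // X.card = j} → Finset (Finset α) := fun X =>
    Finset.univ.filter fun Y => X.1 ⊆ Y ∧ Y.card = j + 1
  have hall : ∀ s : Finset {X : Finset α // X.card = j}, s.card ≤ (s.biUnion t).card := by
    intro s
    have hcount := Finset.card_mul_le_card_mul (s := s) (t := s.biUnion t)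
      (fun X Y => X.1 ⊆ Y) (m := Fintype.card α - j) (n := j + 1) ?_ ?_
    · have h1 : s.card * (j + 1) ≤ s.card * (Fintype.card α - j) :=
        Nat.mul_le_mul_left _ (by omega)
      exact Nat.le_of_mul_le_mul_right (h1.trans hcount) (Nat.succ_pos j)
    · intro X hX
      have hsub : X.1ᶜ.image (fun a => insert a X.1) ⊆
          (s.biUnion t).bipartiteAbove (fun X Y => X.1 ⊆ Y) X := by
        intro Y hY
        obtain ⟨a, ha, rfl⟩ := Finset.mem_image.1 hY
        rw [Finset.mem_compl] at ha
        rw [Finset.mem_bipartiteAbove, Finset.mem_biUnion]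
        refine ⟨⟨X, hX, Finset.mem_filter.2 ⟨Finset.mem_univ _, Finset.subset_insert _ _, ?_⟩⟩,
          Finset.subset_insert _ _⟩
        rw [Finset.card_insert_of_notMem ha, X.2]
      refine le_trans (le_of_eq ?_) (Finset.card_le_card hsub)
      rw [Finset.card_image_of_injOn, Finset.card_compl, X.2]
      intro a ha b hb hab
      rw [Finset.mem_coe, Finset.mem_compl] at ha
      have : a ∈ insert b X.1 := by
        rw [← show insert a X.1 = insert b X.1 from hab]
        exact Finset.mem_insert_self _ _
      exact (Finset.mem_insert.1 this).resolve_right ha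
    · intro Y hY
      obtain ⟨X, -, hX⟩ := Finset.mem_biUnion.1 hY
      have hYc : Y.card = j + 1 := (Finset.mem_filter.1 hX).2.2
      have hle : ((s.bipartiteBelow (fun X Y => X.1 ⊆ Y) Y).map
          (Function.Embedding.subtype _)).card ≤ (Y.powersetCard j).card := by
        refine Finset.card_le_card fun Z hZ => ?_
        obtain ⟨W, hW, rfl⟩ := Finset.mem_map.1 hZ
        exact Finset.mem_powersetCard.2 ⟨((Finset.mem_bipartiteBelow _).1 hW).2, W.2⟩
      rwa [Finset.card_map, Finset.card_powersetCard, hYc, Nat.choose_succ_self_right] at hle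
  obtain ⟨φ, hφ, hφt⟩ := (Finset.all_card_le_biUnion_card_iff_exists_injective t).1 hall
  exact ⟨φ, hφ, fun X => (Finset.mem_filter.1 (hφt X)).2⟩

/-- Inverting the injections between consecutive levels: one element can be removed from every
non-empty set in such a way that every set below the middle arises. -/
lemma exists_descent : ∃ ψ : Finset α → Finset α,
    (∀ A, ψ A ⊆ A ∧ (ψ A).card = A.card - 1) ∧
      ∀ X : Finset α, 2 * X.card < Fintype.card α → ∃ A, A.card = X.card + 1 ∧ ψ A = X := by
  classical
  have hstep : ∀ j : ℕ, ∃ ψ : Finset α → Finset α,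
      (∀ A, ψ A ⊆ A ∧ (ψ A).card = A.card - 1) ∧ (2 * j < Fintype.card α →
        ∀ X : Finset α, X.card = j → ∃ A, A.card = X.card + 1 ∧ ψ A = X) := by
    intro j
    have hbelow : ∀ A : Finset α, ∃ B ⊆ A, B.card = A.card - 1 := fun A =>
      Finset.exists_subset_card_eq (Nat.sub_le _ _)
    choose β hβ1 hβ2 using hbelow
    by_cases hj : 2 * j < Fintype.card α
    · obtain ⟨φ, hφ, hφ'⟩ := exists_injective_upward (α := α) hj
      refine ⟨fun A => if h : ∃ X, φ X = A then h.choose.1 else β A, fun A => ?_,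
        fun _ X hX => ⟨φ ⟨X, hX⟩, by rw [(hφ' _).2, hX], ?_⟩⟩
      · dsimp only
        split_ifs with h
        · have h1 := hφ' h.choose
          rw [h.choose_spec] at h1
          exact ⟨h1.1, by rw [h1.2, h.choose.2]; rfl⟩
        · exact ⟨hβ1 A, hβ2 A⟩
      · have h : ∃ X', φ X' = φ ⟨X, hX⟩ := ⟨_, rfl⟩
        dsimp only
        rw [dif_pos h, hφ h.choose_spec]
    · exact ⟨β, fun A => ⟨hβ1 A, hβ2 A⟩, fun h => absurd h hj⟩
  choose ψ hψ1 hψ2 using hstep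
  refine ⟨fun A => ψ (A.card - 1) A, fun A => hψ1 _ A, fun X hX => ?_⟩
  obtain ⟨A, hA, hAX⟩ := hψ2 X.card hX X rfl
  exact ⟨A, hA, by simpa [hA] using hAX⟩

lemma iterate_descent {α : Type*} {ψ : Finset α → Finset α}
    (hψ : ∀ A, ψ A ⊆ A ∧ (ψ A).card = A.card - 1) (A : Finset α) (d : ℕ) :
    ψ^[d] A ⊆ A ∧ (ψ^[d] A).card = A.card - d := by
  induction d with
  | zero => simp
  | succ d ih =>
    rw [Function.iterate_succ_apply']
    refine ⟨(hψ _).1.trans ih.1, ?_⟩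
    rw [(hψ _).2, ih.2]
    omega

lemma exists_iterate_descent_eq {α : Type*} [Fintype α] {ψ : Finset α → Finset α}
    (hψ : ∀ X : Finset α, 2 * X.card < Fintype.card α → ∃ A, A.card = X.card + 1 ∧ ψ A = X)
    (d : ℕ) (X : Finset α) (hX : X.card + d = Fintype.card α / 2) :
    ∃ A : Finset α, A.card = Fintype.card α / 2 ∧ ψ^[d] A = X := by
  induction d generalizing X with
  | zero => exact ⟨X, by omega, rfl⟩
  | succ d ih =>
    obtain ⟨Y, hY, rfl⟩ := hψ X (by omega)
    obtain ⟨A, hA, rfl⟩ := ih Y (by omega)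
    exact ⟨A, hA, Function.iterate_succ_apply' _ _ _⟩

/-- The chain through two disjoint sets `A` and `B` of half the size: it climbs up to `A` along the
sets below `A`, and continues with the complements of the sets below `B`. -/
def throughChain (ψ : Finset α → Finset α) (A B : Finset α) (j : ℕ) : Finset α :=
  if j ≤ Fintype.card α / 2 then ψ^[Fintype.card α / 2 - j] A
  else (ψ^[Fintype.card α / 2 - (Fintype.card α - j)] B)ᶜ

lemma isGradedChain_throughChain {ψ : Finset α → Finset α}
    (hψ : ∀ A, ψ A ⊆ A ∧ (ψ A).card = A.card - 1) {A B : Finset α}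
    (hA : A.card = Fintype.card α / 2) (hB : B.card = Fintype.card α / 2) (hAB : Disjoint A B) :
    IsGradedChain (throughChain ψ A B) where
  mono := by
    have hanti : ∀ (X : Finset α) {d d' : ℕ}, d' ≤ d → ψ^[d] X ⊆ ψ^[d'] X := by
      intro X d d' h
      obtain ⟨c, rfl⟩ := Nat.exists_eq_add_of_le' h
      rw [Function.iterate_add_apply]
      exact (iterate_descent hψ _ c).1
    intro j j' h
    unfold throughChain
    split_ifs with h1 h2 h2
    · exact hanti A (by omega)
    · rw [Finset.subset_compl_iff_disjoint_right]
      exact hAB.mono (iterate_descent hψ _ _).1 (iterate_descent hψ _ _).1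
    · omega
    · exact Finset.compl_subset_compl.2 (hanti B (by omega))
  card_eq := by
    intro j hj
    unfold throughChain
    split_ifs with h1
    · rw [(iterate_descent hψ _ _).2, hA]
      omega
    · rw [Finset.card_compl, (iterate_descent hψ _ _).2, hB]
      omega

/-- With enough features, suitable chains cut off every set. -/
lemma two_mul_partitioningFunction_eq_of_choose_le {ℓ n : ℕ} (hn : 2 ≤ n)
    (hℓ : (Fintype.card α).choose (Fintype.card α / 2) ≤ 2 * ℓ) :
    2 * partitioningFunction (decisionStumps ℓ n) 2 (Fintype.card α) =
      ∑ k ∈ Finset.Ico 1 (Fintype.card α), min (2 * ℓ) ((Fintype.card α).choose k) := by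
  have hpos : 0 < (Fintype.card α).choose (Fintype.card α / 2) :=
    Nat.choose_pos (Nat.div_le_self _ _)
  obtain ⟨A, B, hA, hB, hAB, hcover⟩ := exists_disjoint_pairs hℓ
  obtain ⟨ψ, hψ, hψ'⟩ := exists_descent (α := α)
  let C : Fin ℓ → ℕ → Finset α := fun i => throughChain ψ (A i) (B i)
  have hlow : ∀ X : Finset α, X.card ≤ Fintype.card α / 2 → X ∈ chainCuts C X.card := by
    intro X hX
    obtain ⟨Y, hY, hYX⟩ := exists_iterate_descent_eq hψ' (Fintype.card α / 2 - X.card) X (by omega)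
    rw [chainCuts, Finset.mem_union]
    obtain ⟨i, rfl | rfl⟩ := hcover Y hY
    · exact Or.inl (Finset.mem_image.2 ⟨i, Finset.mem_univ i, (if_pos hX).trans hYX⟩)
    · refine Or.inr (Finset.mem_image.2 ⟨i, Finset.mem_univ i, ?_⟩)
      change (throughChain ψ (A i) (B i) (Fintype.card α - X.card))ᶜ = X
      by_cases hm : Fintype.card α - X.card ≤ Fintype.card α / 2
      · -- Here `X` has exactly half the size, so it is `B i` itself.
        have h0 : Fintype.card α / 2 - X.card = 0 := by omega
        have h1 : Fintype.card α / 2 - (Fintype.card α - X.card) = 0 := by omega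
        rw [h0, Function.iterate_zero, id] at hYX
        rw [throughChain, if_pos hm, h1, Function.iterate_zero, id, ← hYX]
        refine (Finset.eq_of_subset_of_card_le ?_ ?_).symm
        · rw [Finset.subset_compl_iff_disjoint_right]
          exact (hAB i).symm
        · rw [Finset.card_compl, hA, hB]
          omega
      · rw [throughChain, if_neg hm, compl_compl,
          Nat.sub_sub_self (by omega : X.card ≤ Fintype.card α), hYX]
  refine two_mul_partitioningFunction_eq_of_chains hn (by omega) C
    (fun i => isGradedChain_throughChain hψ (hA i) (hB i) (hAB i)) fun k hk => ?_
  rw [Finset.mem_Ico] at hk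
  refine (min_le_right _ _).trans ?_
  rw [← Finset.card_univ, ← Finset.card_powersetCard]
  refine Finset.card_le_card fun X hX => ?_
  rw [Finset.mem_powersetCard] at hX
  obtain ⟨-, rfl⟩ := hX
  by_cases hX : X.card ≤ Fintype.card α / 2
  · exact hlow X hX
  · have h := hlow Xᶜ (by rw [Finset.card_compl]; omega)
    simp only [chainCuts, Finset.mem_union, Finset.mem_image, Finset.mem_univ, true_and,
      Finset.card_compl, compl_inj_iff, Nat.sub_sub_self hk.2.le] at h ⊢
    rcases h with ⟨i, hi⟩ | ⟨i, hi⟩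
    · exact Or.inr ⟨i, by rw [hi, compl_compl]⟩
    · exact Or.inl ⟨i, hi⟩

end DisjointPairs

/-! ### Chains given by orderings, and samples of at most seven points -/

section Orderings

variable {m : ℕ}

/-- The initial segments of an ordering of `Fin m` form a chain. -/
def orderingChain (l : List (Fin m)) (j : ℕ) : Finset (Fin m) := (l.take j).toFinset

lemma isGradedChain_orderingChain {l : List (Fin m)} (hl : l.Nodup) (hlen : l.length = m) :
    IsGradedChain (orderingChain l) where
  mono := by
    intro j j' h x hx
    rw [orderingChain, List.mem_toFinset] at hx ⊢
    exact (List.take_prefix_take_left h).subset hx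
  card_eq := by
    intro j hj
    rw [Fintype.card_fin] at hj
    rw [orderingChain, List.toFinset_card_of_nodup (hl.sublist (List.take_sublist _ _)),
      List.length_take, hlen, min_eq_left hj]

/-- The number whose binary digits indicate the members of a duplicate-free list. -/
def binaryCode (l : List (Fin m)) : ℕ := (l.map fun p : Fin m => 2 ^ (p : ℕ)).sum

lemma binaryCode_eq_sum {l : List (Fin m)} (hl : l.Nodup) :
    binaryCode l = ∑ p ∈ l.toFinset, 2 ^ (p : ℕ) := by
  rw [binaryCode, List.sum_toFinset _ hl]

/-- The binary codes of the initial and of the final segments of length `k` of some orderings. -/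
def segmentCodes (L : List (List (Fin m))) (k : ℕ) : List ℕ :=
  L.flatMap fun l => [binaryCode (l.take k), binaryCode (l.drop (m - k))]

lemma card_segmentCodes_le {L : List (List (Fin m))} (hL : ∀ l ∈ L, l.Nodup ∧ l.length = m)
    {ℓ : ℕ} (hℓ : ℓ ≤ L.length) (k : ℕ) :
    (segmentCodes (L.take ℓ) k).toFinset.card ≤
      (chainCuts (fun i : Fin ℓ => orderingChain (L.get (i.castLE hℓ))) k).card := by
  refine le_trans (Finset.card_le_card ?_)
    (Finset.card_image_le (f := fun A : Finset (Fin m) => ∑ p ∈ A, 2 ^ (p : ℕ)))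
  intro c hc
  simp only [segmentCodes, List.mem_toFinset, List.mem_flatMap, List.mem_cons,
    List.not_mem_nil, or_false] at hc
  obtain ⟨l, hl, hc⟩ := hc
  obtain ⟨i, hi, rfl⟩ := List.mem_take_iff_getElem.1 hl
  have hiℓ : i < ℓ := hi.trans_le (min_le_left _ _)
  obtain ⟨hnd, hlen⟩ := hL _ (List.mem_of_mem_take hl)
  rw [Finset.mem_image]
  rcases hc with rfl | rfl
  · refine ⟨_, Finset.mem_union_left _ (Finset.mem_image_of_mem _ (Finset.mem_univ ⟨i, hiℓ⟩)), ?_⟩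
    rw [binaryCode_eq_sum (hnd.sublist (List.take_sublist _ _))]
    rfl
  · refine ⟨_, Finset.mem_union_right _ (Finset.mem_image_of_mem _ (Finset.mem_univ ⟨i, hiℓ⟩)), ?_⟩
    rw [binaryCode_eq_sum (hnd.sublist (List.drop_sublist _ _))]
    refine Finset.sum_congr ?_ fun _ _ => rfl
    rw [Fintype.card_fin]
    change (L[i].take (m - k)).toFinsetᶜ = (L[i].drop (m - k)).toFinset
    have huniv : L[i].toFinset = Finset.univ := by
      rw [← Finset.card_eq_iff_eq_univ, List.toFinset_card_of_nodup hnd, hlen, Fintype.card_fin]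
    have hsplit := List.take_append_drop (m - k) L[i]
    rw [← hsplit] at hnd huniv
    rw [List.toFinset_append] at huniv
    refine IsCompl.compl_eq ⟨?_, ?_⟩
    · rw [Finset.disjoint_left]
      intro x hx hx'
      rw [List.mem_toFinset] at hx hx'
      exact List.disjoint_of_nodup_append hnd hx hx'
    · rw [codisjoint_iff]
      exact huniv

lemma two_mul_partitioningFunction_eq_of_orderings {ℓ n : ℕ} (hn : 2 ≤ n) (hℓ : 0 < ℓ)
    (L : List (List (Fin m))) (hL : ∀ l ∈ L, l.Nodup ∧ l.length = m) (hlen : ℓ ≤ L.length)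
    (hcodes : ∀ k ∈ Finset.Ico 1 m,
      min (2 * ℓ) (m.choose k) ≤ (segmentCodes (L.take ℓ) k).toFinset.card) :
    2 * partitioningFunction (decisionStumps ℓ n) 2 m =
      ∑ k ∈ Finset.Ico 1 m, min (2 * ℓ) (m.choose k) := by
  have := two_mul_partitioningFunction_eq_of_chains (α := Fin m) hn hℓ
    (fun i : Fin ℓ => orderingChain (L.get (i.castLE hlen)))
    (fun i => isGradedChain_orderingChain (hL _ (List.get_mem _ _)).1 (hL _ (List.get_mem _ _)).2)
    (fun k hk => by
      rw [Fintype.card_fin] at hk ⊢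
      exact (hcodes k hk).trans (card_segmentCodes_le hL hlen k))
  rwa [Fintype.card_fin] at this

end Orderings

/-- Orderings of `5` points. At every level, each further ordering cuts off two new sets for as
long as there are two left, and then the remaining one, if any. -/
def orderingsFive : List (List (Fin 5)) :=
  [[3, 2, 4, 1, 0], [2, 1, 3, 0, 4], [3, 0, 2, 4, 1],
    [4, 2, 0, 3, 1]]

lemma orderingsFive_spec : (∀ l ∈ orderingsFive, l.Nodup ∧ l.length = 5) ∧
    ∀ ℓ < 5, ∀ k ∈ Finset.Ico 1 5, min (2 * ℓ) (Nat.choose 5 k) ≤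
      (segmentCodes (orderingsFive.take ℓ) k).toFinset.card := by
  decide +kernel

/-- Orderings of `6` points. At every level, each further ordering cuts off two new sets for as
long as there are two left. -/
def orderingsSix : List (List (Fin 6)) :=
  [[3, 5, 4, 0, 1, 2], [5, 0, 2, 1, 3, 4], [0, 4, 5, 2, 3, 1],
    [0, 1, 5, 4, 2, 3], [0, 3, 1, 5, 2, 4], [1, 5, 3, 4, 2, 0],
    [4, 1, 0, 3, 2, 5], [0, 3, 2, 1, 5, 4], [0, 5, 3, 2, 4, 1]]

lemma orderingsSix_spec : (∀ l ∈ orderingsSix, l.Nodup ∧ l.length = 6) ∧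
    ∀ ℓ < 10, ∀ k ∈ Finset.Ico 1 6, min (2 * ℓ) (Nat.choose 6 k) ≤
      (segmentCodes (orderingsSix.take ℓ) k).toFinset.card := by
  decide +kernel

/-- Orderings of `7` points. At every level, each further ordering cuts off two new sets for as
long as there are two left, and then the remaining one, if any. -/
def orderingsSeven : List (List (Fin 7)) :=
  [[4, 3, 6, 1, 2, 5, 0], [2, 4, 0, 5, 6, 1, 3], [6, 5, 2, 4, 3, 0, 1],
    [6, 4, 0, 2, 1, 3, 5], [0, 3, 5, 1, 4, 6, 2], [6, 3, 5, 0, 4, 1, 2],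
    [4, 0, 5, 1, 6, 3, 2], [2, 5, 4, 3, 0, 1, 6], [0, 2, 3, 6, 1, 4, 5],
    [0, 6, 3, 4, 2, 1, 5], [0, 2, 6, 5, 3, 1, 4], [4, 0, 3, 2, 6, 1, 5],
    [3, 2, 4, 6, 1, 5, 0], [1, 6, 2, 0, 3, 4, 5], [2, 5, 3, 6, 4, 0, 1],
    [1, 2, 3, 4, 6, 5, 0], [2, 0, 1, 3, 4, 5, 6]]

lemma orderingsSeven_spec : (∀ l ∈ orderingsSeven, l.Nodup ∧ l.length = 7) ∧
    ∀ ℓ < 18, ∀ k ∈ Finset.Ico 1 7, min (2 * ℓ) (Nat.choose 7 k) ≤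
      (segmentCodes (orderingsSeven.take ℓ) k).toFinset.card := by
  decide +kernel

/-- Samples of at most seven points. Apart from the explicit orderings, `2 * ℓ ≤ m` or
`m.choose (m / 2) ≤ 2 * ℓ` always holds. -/
lemma two_mul_partitioningFunction_eq_of_le_seven {ℓ n m : ℕ} (hn : 2 ≤ n) (hℓ : 0 < ℓ)
    (hm1 : 1 ≤ m) (hm : m ≤ 7) : 2 * partitioningFunction (decisionStumps ℓ n) 2 m =
      ∑ k ∈ Finset.Ico 1 m, min (2 * ℓ) (m.choose k) := by
  by_cases h1 : 2 * ℓ ≤ m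
  · exact two_mul_partitioningFunction_eq_of_two_mul_le hn hℓ h1
  by_cases h2 : m.choose (m / 2) ≤ 2 * ℓ
  · simpa using two_mul_partitioningFunction_eq_of_choose_le (α := Fin m) hn (by simpa using h2)
  interval_cases m <;> simp only [Nat.choose, Nat.reduceDiv] at h2
  · omega
  · omega
  · omega
  · omega
  · exact two_mul_partitioningFunction_eq_of_orderings hn hℓ orderingsFive orderingsFive_spec.1
      (by simp only [orderingsFive, List.length_cons, List.length_nil]; omega)
      (orderingsFive_spec.2 ℓ (by omega))
  · exact two_mul_partitioningFunction_eq_of_orderings hn hℓ orderingsSix orderingsSix_spec.1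
      (by simp only [orderingsSix, List.length_cons, List.length_nil]; omega)
      (orderingsSix_spec.2 ℓ (by omega))
  · exact two_mul_partitioningFunction_eq_of_orderings hn hℓ orderingsSeven orderingsSeven_spec.1
      (by simp only [orderingsSeven, List.length_cons, List.length_nil]; omega)
      (orderingsSeven_spec.2 ℓ (by omega))

/-! ### The bound and its cases of equality -/

theorem theorem1 (ℓ n : ℕ) (hn : 2 ≤ n) (m : ℕ) :
    (partitioningFunction (decisionStumps ℓ n) 2 m : ℝ)
        ≤ (1 / 2 : ℝ) * ∑ k ∈ Finset.Ico 1 m, min (2 * (ℓ : ℝ)) (m.choose k : ℝ) ∧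
    ((2 * ℓ ≤ m ∨ m.choose (m / 2) ≤ 2 * ℓ ∨ (1 ≤ m ∧ m ≤ 7)) →
      (partitioningFunction (decisionStumps ℓ n) 2 m : ℝ)
        = (1 / 2 : ℝ) * ∑ k ∈ Finset.Ico 1 m, min (2 * (ℓ : ℝ)) (m.choose k : ℝ)) := by
  have hsum : ((∑ k ∈ Finset.Ico 1 m, min (2 * ℓ) (m.choose k) : ℕ) : ℝ) =
      ∑ k ∈ Finset.Ico 1 m, min (2 * (ℓ : ℝ)) (m.choose k : ℝ) := by
    push_cast
    rfl
  have hle := two_mul_partitioningFunction_le (ℓ := ℓ) hn m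
  rw [← hsum]
  refine ⟨?_, fun h => ?_⟩
  · have : (2 * partitioningFunction (decisionStumps ℓ n) 2 m : ℝ) ≤
        (∑ k ∈ Finset.Ico 1 m, min (2 * ℓ) (m.choose k) : ℕ) := by exact_mod_cast hle
    linarith
  · have heq : 2 * partitioningFunction (decisionStumps ℓ n) 2 m =
        ∑ k ∈ Finset.Ico 1 m, min (2 * ℓ) (m.choose k) := by
      rcases Nat.eq_zero_or_pos ℓ with rfl | hℓ
      · -- Without features the upper bound is `0`.
        refine le_antisymm hle ?_
        simp
      rcases h with h | h | ⟨h1, h2⟩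
      · exact two_mul_partitioningFunction_eq_of_two_mul_le hn hℓ h
      · simpa using two_mul_partitioningFunction_eq_of_choose_le (α := Fin m) hn (by simpa using h)
      · exact two_mul_partitioningFunction_eq_of_le_seven hn hℓ h1 h2
    have : (2 * partitioningFunction (decisionStumps ℓ n) 2 m : ℝ) =
        (∑ k ∈ Finset.Ico 1 m, min (2 * ℓ) (m.choose k) : ℕ) := by exact_mod_cast heq
    linarith
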